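/- Let $p$ be an odd prime and let $\mathbb{Z}_p$ denote the ring of $p$-adic integers. Let $G$ be a finite $p$-group, and let $M$ be a module over the group ring $\mathbb{Z}_pG$ which is free of finite rank as a $\mathbb{Z}_p$-module and on which $G$ acts faithfully (that is, the only element $g \in G$ with $g\cdot m = m$ for all $m \in M$ is $g = 1$). Let $d(G)$ denote the minimal cardinality of a generating set of the group $G$, let $d_{\mathbb{Z}_pG}(M)$ denote the minimal cardinality of a generating set of $M$ as a $\mathbb{Z}_pG$-module, and let $\dim_{\mathbb{Z}_p}(M)$ denote the rank of the free $\mathbb{Z}_p$-module $M$. Then $$d(G) + d_{\mathbb{Z}_pG}(M) \le \dim_{\mathbb{Z}_p}(M).$$ -/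

import Mathlib

/-!
Write `n` and `a` for the ranks of `M` and of its invariants `M^G`, and `d(M)` for the number of
generators of `M` over the group ring. Two inequalities add up to the theorem:

* `2 d(M) ≤ n + a` (`Representation.modAug_index_sq_le`), for any action, and
* `2 d(G) ≤ n - a` (`index_pFrattini_sq_mul_le`), for a faithful action.

Here `p ^ d(M)` is the index of `pM + ∑ (g - 1)M` by Nakayama's lemma, and `p ^ d(G)` is the order
of the largest elementary abelian quotient of `G` by Burnside's basis theorem; all counting is done
with these two indices.

For the first inequality, let `z` act as a central element of order `p` and put `f = z - 1`. The
kernel of `f` is a lattice of smaller rank, so it suffices to show that `f(M) / f²(M)` has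
dimension at most half the rank of `f(M)`. Since `p` is odd, expanding `(1 + f) ^ p = 1` gives
`p f(M) ⊆ f³(M)`, and `f` is injective on `f(M)`, so two copies of `f(M) / f²(M)` fit into
`f(M) / p f(M)`.

For the second, let `A` be a maximal abelian normal subgroup, which contains its centralizer, and
let `I` be the set of nontrivial characters of `A` occurring in `M` over a cyclotomic extension of
the `p`-adic numbers. Weight spaces are independent, so `|I| ≤ n - a`. The set `I` is stable under
`G`, and under inversion by Galois theory, because the cyclotomic polynomials of `p`-power order
are irreducible over the `p`-adic numbers; inversion has no fixed points as `p` is odd. The odd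
functions `y : I → ℤ_[p]` for which `χ ↦ ζ ^ y χ` is evaluation at an element of `A` form a lattice
`Y` of rank at most `|I| / 2`, which maps `G`-equivariantly onto `A`. Hence `G ⧸ A` acts faithfully
on `Y`, and the elementary abelian quotient of coinvariants of `A` is a quotient of that of `Y`.
By induction, `d(G) ≤ d(G ⧸ A) + d(Y) ≤ rank Y ≤ (n - a) / 2`.
-/

/-! ### Indices of subgroups of lattices -/

/-- The subgroup `pM` has index `p ^ n` in a lattice `M` of rank `n`. -/
theorem index_range_nsmul_prime (p : ℕ) [Fact p.Prime] (M : Type*) [AddCommGroup M]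
    [Module ℤ_[p] M] [Module.Free ℤ_[p] M] [Module.Finite ℤ_[p] M] :
    (nsmulAddMonoidHom (α := M) p).range.index = p ^ Module.finrank ℤ_[p] M := by
  classical
  let b := Module.finBasis ℤ_[p] M
  let φ : M →+ (Fin (Module.finrank ℤ_[p] M) → ZMod p) :=
    { toFun := fun x i => PadicInt.toZMod (b.repr x i)
      map_zero' := by ext i; simp
      map_add' := fun x y => by ext i; simp }
  have hsurj : Function.Surjective φ := by
    intro v
    refine ⟨∑ i, ((v i).val : ℤ_[p]) • b i, ?_⟩
    ext i
    change PadicInt.toZMod (b.repr _ i) = v i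
    rw [b.repr_sum_self]
    simp
  have hker : φ.ker = (nsmulAddMonoidHom (α := M) p).range := by
    ext x
    constructor
    · intro hx
      have h1 : ∀ i, ∃ c : ℤ_[p], b.repr x i = p * c := by
        intro i
        have h2 : PadicInt.toZMod (b.repr x i) = 0 := congrFun hx i
        have h3 : b.repr x i ∈ RingHom.ker (PadicInt.toZMod (p := p)) := h2
        rw [PadicInt.ker_toZMod, PadicInt.maximalIdeal_eq_span_p, Ideal.mem_span_singleton] at h3
        exact h3
      choose c hc using h1
      refine ⟨∑ i, c i • b i, ?_⟩
      apply b.repr.injective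
      ext i
      rw [hc i]
      simp [Finsupp.single_apply]
    · rintro ⟨y, rfl⟩
      ext i
      change PadicInt.toZMod (b.repr (p • y) i) = 0
      simp
  rw [← hker, AddSubgroup.index_ker, φ.range_eq_top.2 hsurj]
  simp

/-- If `f` satisfies `p f (M) ⊆ f³(M)` and is injective on `f(M)`, then the index of `f²(M)` in
`f(M)` is at most the square root of the index of `p f(M)` in `f(M)`. -/
theorem relIndex_range_sq_le {p : ℕ} [Fact p.Prime] {M : Type*} [AddCommGroup M]
    [Module ℤ_[p] M] [Module.Free ℤ_[p] M] [Module.Finite ℤ_[p] M] (f : Module.End ℤ_[p] M)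
    (hinj : ∀ x, f (f x) = 0 → f x = 0) (hp : ∀ x, ∃ y, p • f x = f (f (f y))) :
    ((f.toAddMonoidHom.comp f.toAddMonoidHom).range.relIndex f.toAddMonoidHom.range) ≠ 0 ∧
    ((f.toAddMonoidHom.comp f.toAddMonoidHom).range.relIndex f.toAddMonoidHom.range) ^ 2 ≤
      p ^ Module.finrank ℤ_[p] (LinearMap.range f) := by
  set F := f.toAddMonoidHom
  have hF : ∀ x, F x = f x := fun _ => rfl
  set R := F.range
  set R2 := (F.comp F).range
  set R3 := (F.comp (F.comp F)).range
  have h21 : R2 ≤ R := by rintro _ ⟨x, rfl⟩; exact ⟨F x, rfl⟩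
  have h32 : R3 ≤ R2 := by rintro _ ⟨x, rfl⟩; exact ⟨F x, rfl⟩
  let φ : R →+ M := F.comp R.subtype
  have hφ : Function.Injective φ := by
    rw [injective_iff_map_eq_zero]
    rintro ⟨_, x, rfl⟩ hx
    exact Subtype.ext (hinj x hx)
  -- `f` restricts to an isomorphism from `f(M)` to `f²(M)`, taking `f²(M)` to `f³(M)`
  have e1 : R3.relIndex R2 = R2.relIndex R := by
    have a1 : (R2.addSubgroupOf R).map φ = R3 := by
      ext y
      constructor
      · rintro ⟨⟨_, x, rfl⟩, ⟨z, hz⟩, rfl⟩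
        exact ⟨z, congrArg F hz⟩
      · rintro ⟨z, rfl⟩
        exact ⟨⟨F (F z), F z, rfl⟩, ⟨z, rfl⟩, rfl⟩
    have a2 : (⊤ : AddSubgroup R).map φ = R2 := by
      ext y
      constructor
      · rintro ⟨⟨_, x, rfl⟩, -, rfl⟩
        exact ⟨x, rfl⟩
      · rintro ⟨z, rfl⟩
        exact ⟨⟨F z, z, rfl⟩, trivial, rfl⟩
    rw [← a1, ← a2, AddSubgroup.relIndex_map_map_of_injective _ _ hφ,
      AddSubgroup.relIndex_top_right, a2]
    rfl
  have e2 : R3.relIndex R = R2.relIndex R ^ 2 := by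
    rw [← AddSubgroup.relIndex_mul_relIndex R3 R2 R h32 h21, e1, sq]
  let N := LinearMap.range f
  let K : AddSubgroup N := R3.addSubgroupOf R
  have e3 : (nsmulAddMonoidHom (α := N) p).range ≤ K := by
    rintro _ ⟨⟨_, x, rfl⟩, rfl⟩
    obtain ⟨y, hy⟩ := hp x
    exact ⟨y, hy.symm⟩
  have e4 := index_range_nsmul_prime p N
  have hne : (nsmulAddMonoidHom (α := N) p).range.index ≠ 0 := by
    rw [e4]; exact pow_ne_zero _ (Fact.out : p.Prime).ne_zero
  have : (nsmulAddMonoidHom (α := N) p).range.FiniteIndex := ⟨hne⟩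
  have e5 : R3.relIndex R ≤ p ^ Module.finrank ℤ_[p] N := by
    rw [← e4]
    exact @AddSubgroup.index_antitone N _ _ K e3 this
  have e6 : R3.relIndex R ≠ 0 := (@AddSubgroup.finiteIndex_of_le N _ _ K this e3).index_ne_zero
  rw [e2] at e5 e6
  exact ⟨fun h => e6 (by rw [h]; rfl), e5⟩

/-- The binomial expansion modulo cubes, in a possibly noncommutative ring. -/
theorem exists_one_add_pow_eq {R : Type*} [Ring R] (f : R) (n : ℕ) :
    ∃ q : R, Commute f q ∧ (1 + f) ^ n = 1 + n * f + (n.choose 2) * f ^ 2 + f ^ 3 * q := by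
  induction n with
  | zero => exact ⟨0, Commute.zero_right f, by simp⟩
  | succ n ih =>
    obtain ⟨q, hfq, hq⟩ := ih
    refine ⟨(n.choose 2) + q * (1 + f), (Nat.commute_cast f _).add_right
      (hfq.mul_right ((Commute.one_right f).add_right (Commute.refl f))), ?_⟩
    have hc : (n + 1).choose 2 = n + n.choose 2 := by
      rw [Nat.choose_succ_succ' n 1, Nat.choose_one_right]
    have h3 : ((n.choose 2 : ℕ) : R) * f ^ 3 = f ^ 3 * (n.choose 2 : ℕ) := Nat.cast_commute _ _
    rw [pow_succ, hq, hc, mul_add (f ^ 3), ← h3]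
    push_cast
    noncomm_ring

/-- For odd `p`, an endomorphism `1 + f` with `(1 + f) ^ p = 1` satisfies `p f(M) ⊆ f³(M)`, and
`p` kills `f(M) ∩ ker f`. This uses that `p` divides `p.choose 2`. -/
theorem prime_smul_mem_range_cube {p : ℕ} (hp : Odd p) {R M : Type*} [Ring R]
    [AddCommGroup M] [Module R M] (f : Module.End R M) (h : (1 + f) ^ p = 1) :
    (∀ x, f (f x) = 0 → p • f x = 0) ∧ ∀ x, ∃ y, p • f x = f (f (f y)) := by
  obtain ⟨q, hfq, hq⟩ := exists_one_add_pow_eq f p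
  obtain ⟨m, hm⟩ := hp
  have hc : p.choose 2 = p * m := by
    rw [Nat.choose_two_right, hm, Nat.add_sub_cancel]
    rw [show (2 * m + 1) * (2 * m) = ((2 * m + 1) * m) * 2 by ring, Nat.mul_div_cancel _ two_pos]
  have key : ∀ x, p • f x = -(m • f (p • f x)) - f (f (f (q x))) := by
    intro x
    have h1 := congrArg (fun g : Module.End R M => g x) (h.symm.trans hq)
    simp only [hc, pow_succ, pow_zero, one_mul, LinearMap.add_apply, Module.End.mul_apply,
      Module.End.one_apply, Module.End.natCast_apply] at h1
    have h2 : p • f x + (p * m) • f (f x) + f (f (f (q x))) = 0 := by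
      have h3 : x + 0 = x + (p • f x + (p * m) • f (f x) + f (f (f (q x)))) := by
        rw [add_zero]; nth_rewrite 1 [h1]; abel
      exact (add_left_cancel h3).symm
    have h4 : (p * m) • f (f x) = m • f (p • f x) := by
      rw [mul_comm, mul_smul, map_nsmul]
    rw [h4] at h2
    rw [eq_comm, ← sub_eq_zero, ← neg_eq_zero, ← h2]
    abel
  refine ⟨fun x hx => ?_, fun x => ?_⟩
  · have h1 : ∀ y, f (q y) = q (f y) := fun y => congrArg (fun g : Module.End R M => g y) hfq
    rw [key x, map_nsmul, hx, h1, h1, hx]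
    simp
  · refine ⟨m • (m • (p • x) + f (q x)) - q x, ?_⟩
    rw [key x, key x]
    simp only [map_add, map_sub, map_neg, map_nsmul, smul_add, smul_sub, smul_neg]
    abel

/-! ### Coinvariants modulo `p` -/

/-- The subgroup `pM + ∑ (g - 1)M` of a representation `M` of `G`; the quotient by it is the
largest elementary abelian `p`-quotient of `M` on which `G` acts trivially. -/
def Representation.modAug {p : ℕ} [Fact p.Prime] {G M : Type*} [Group G] [AddCommGroup M]
    [Module ℤ_[p] M] (ρ : Representation ℤ_[p] G M) : AddSubgroup M :=
  AddSubgroup.closure ({y | ∃ x, p • x = y} ∪ {y | ∃ g x, ρ g x - x = y})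

namespace Representation

variable {p : ℕ} [Fact p.Prime] {G M : Type*} [Group G] [AddCommGroup M] [Module ℤ_[p] M]
  (ρ : Representation ℤ_[p] G M)

theorem nsmul_mem_modAug (x : M) : p • x ∈ ρ.modAug :=
  AddSubgroup.subset_closure (Or.inl ⟨x, rfl⟩)

theorem sub_mem_modAug (g : G) (x : M) : ρ g x - x ∈ ρ.modAug :=
  AddSubgroup.subset_closure (Or.inr ⟨g, x, rfl⟩)

theorem modAug_le {K : AddSubgroup M} (h1 : ∀ x, p • x ∈ K) (h2 : ∀ g x, ρ g x - x ∈ K) :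
    ρ.modAug ≤ K := by
  rw [modAug, AddSubgroup.closure_le]
  rintro _ (⟨x, rfl⟩ | ⟨g, x, rfl⟩)
  · exact h1 x
  · exact h2 g x

theorem modAug_index_ne_zero [Module.Free ℤ_[p] M] [Module.Finite ℤ_[p] M] :
    ρ.modAug.index ≠ 0 := by
  have h1 : (nsmulAddMonoidHom (α := M) p).range ≤ ρ.modAug := by
    rintro _ ⟨x, rfl⟩
    exact ρ.nsmul_mem_modAug x
  have h2 : (nsmulAddMonoidHom (α := M) p).range.FiniteIndex :=
    ⟨by rw [index_range_nsmul_prime]; exact pow_ne_zero _ (Fact.out : p.Prime).ne_zero⟩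
  exact (AddSubgroup.finiteIndex_of_le h1).index_ne_zero

/-- A nontrivial representation of a finite `p`-group has an element acting as a central
element of order `p` of the image. -/
theorem exists_central_of_order_prime [Finite G] (hG : IsPGroup p G) (h : ∃ g, ρ g ≠ 1) :
    ∃ z, ρ z ≠ 1 ∧ ρ z ^ p = 1 ∧ ∀ g, Commute (ρ z) (ρ g) := by
  obtain ⟨g₀, hg₀⟩ := h
  have hQ : IsPGroup p (G ⧸ ρ.ker) := hG.to_quotient _
  have hnt : Nontrivial (G ⧸ ρ.ker) := by
    refine ⟨(g₀ : G ⧸ ρ.ker), 1, fun h => hg₀ ?_⟩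
    exact (QuotientGroup.eq_one_iff _).1 h
  have hc := hQ.center_nontrivial
  obtain ⟨⟨c, hcc⟩, hc1⟩ := exists_prime_orderOf_dvd_card' p
    ((hQ.to_subgroup (Subgroup.center _)).card_eq_or_dvd.resolve_left Finite.one_lt_card.ne')
  obtain ⟨z, rfl⟩ := QuotientGroup.mk_surjective c
  rw [← Subgroup.orderOf_coe] at hc1
  change orderOf (z : G ⧸ ρ.ker) = p at hc1
  refine ⟨z, fun h => ?_, ?_, fun g => ?_⟩
  · rw [(QuotientGroup.eq_one_iff z).2 h, orderOf_one] at hc1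
    exact (Fact.out : p.Prime).one_lt.ne hc1
  · have h1 : ((z ^ p : G) : G ⧸ ρ.ker) = 1 := by
      rw [QuotientGroup.mk_pow]; exact orderOf_dvd_iff_pow_eq_one.1 hc1.dvd
    rw [← map_pow]
    exact (QuotientGroup.eq_one_iff _).1 h1
  · have h1 : ((z * g : G) : G ⧸ ρ.ker) = ((g * z : G) : G ⧸ ρ.ker) :=
      (Subgroup.mem_center_iff.1 hcc (g : G ⧸ ρ.ker)).symm
    rw [QuotientGroup.eq_iff_div_mem, div_eq_mul_inv] at h1
    have h2 : ρ ((z * g) * (g * z)⁻¹) = 1 := h1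
    have h3 : ρ (z * g) = ρ (((z * g) * (g * z)⁻¹) * (g * z)) := by group
    rw [map_mul ρ _ (g * z), h2, one_mul, map_mul, map_mul] at h3
    exact h3

/-- The coinvariants modulo `p` of a lattice of rank `n` with invariants of rank `a` have
dimension at most `(n + a) / 2`. -/
theorem modAug_index_sq_le (hp : Odd p) [Finite G] (hG : IsPGroup p G)
    [Module.Free ℤ_[p] M] [Module.Finite ℤ_[p] M] :
    ρ.modAug.index ^ 2 ≤
      p ^ (Module.finrank ℤ_[p] M + Module.finrank ℤ_[p] ρ.invariants) := by
  induction hn : Module.finrank ℤ_[p] M using Nat.strong_induction_on generalizing M with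
  | _ n ih =>
  by_cases htriv : ∃ g, ρ g ≠ 1
  swap
  · push Not at htriv
    have h1 : ρ.invariants = ⊤ := by
      rw [eq_top_iff]
      intro x _ g
      rw [htriv]; rfl
    have h2 : ρ.modAug = (nsmulAddMonoidHom (α := M) p).range := by
      apply le_antisymm
      · refine ρ.modAug_le (fun x => ⟨x, rfl⟩) fun g x => ?_
        rw [htriv, Module.End.one_apply, sub_self]
        exact zero_mem _
      · rintro _ ⟨x, rfl⟩
        exact ρ.nsmul_mem_modAug x
    rw [h1, finrank_top, h2, index_range_nsmul_prime, hn, ← two_mul, mul_comm, pow_mul]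
  obtain ⟨z, hz1, hzp, hzc⟩ := ρ.exists_central_of_order_prime hG htriv
  set f : Module.End ℤ_[p] M := ρ z - 1 with hf
  have hfz : 1 + f = ρ z := by rw [hf]; abel
  obtain ⟨hcancel, hcube⟩ := prime_smul_mem_range_cube hp f (by rw [hfz, hzp])
  have hinj : ∀ x, f (f x) = 0 → f x = 0 := by
    intro x hx
    have h1 := hcancel x hx
    rw [← Nat.cast_smul_eq_nsmul ℤ_[p]] at h1
    exact (smul_eq_zero.1 h1).resolve_left (by exact_mod_cast (Fact.out : p.Prime).ne_zero)
  have hrange := relIndex_range_sq_le f hinj hcube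
  let K : Submodule ℤ_[p] M := LinearMap.ker f
  have hKinv : ∀ g, K ≤ K.comap (ρ g) := by
    intro g x hx
    rw [Submodule.mem_comap, LinearMap.mem_ker]
    have hcomm : Commute f (ρ g) := (hzc g).sub_left (Commute.one_left _)
    rw [← Module.End.mul_apply, hcomm.eq, Module.End.mul_apply, LinearMap.mem_ker.1 hx, map_zero]
  let ρ₁ := ρ.subrepresentation K hKinv
  have hrank : Module.finrank ℤ_[p] (LinearMap.range f) + Module.finrank ℤ_[p] K = n := by
    rw [← hn, ← f.quotKerEquivRange.finrank_eq]; exact K.finrank_quotient_add_finrank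
  have hpos : 0 < Module.finrank ℤ_[p] (LinearMap.range f) := by
    rw [Module.finrank_pos_iff, Submodule.nontrivial_iff_ne_bot, Ne, LinearMap.range_eq_bot, hf,
      sub_eq_zero]
    exact hz1
  have hih := ih (Module.finrank ℤ_[p] K) (by omega) ρ₁ rfl
  have hinv : Module.finrank ℤ_[p] ρ₁.invariants ≤ Module.finrank ℤ_[p] ρ.invariants := by
    have h1 : ρ₁.invariants.map K.subtype ≤ ρ.invariants := by
      rintro _ ⟨x, hx, rfl⟩ g
      exact congrArg Subtype.val (hx g)
    rw [(Submodule.equivMapOfInjective K.subtype K.subtype_injective ρ₁.invariants).finrank_eq]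
    exact Submodule.finrank_mono h1
  set F := f.toAddMonoidHom
  set J := ρ.modAug
  let K' : AddSubgroup M := K.toAddSubgroup
  have e1 : J.relIndex K' ≤ ρ₁.modAug.index := by
    have h1 : ρ₁.modAug ≤ (J.addSubgroupOf K' : AddSubgroup K) :=
      ρ₁.modAug_le (fun x => ρ.nsmul_mem_modAug (x : M)) fun g x => ρ.sub_mem_modAug g (x : M)
    have h2 : ρ₁.modAug.FiniteIndex := ⟨ρ₁.modAug_index_ne_zero⟩
    exact AddSubgroup.index_antitone h1
  -- on `M / K ≅ f(M)`, the coinvariants of the group are smaller than those of `z` alone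
  have e2 : (J ⊔ K').index ≤ (F.comp F).range.relIndex F.range := by
    have h1 : (F.comp F).range.comap F ≤ J ⊔ K' := by
      rintro x ⟨y, hy⟩
      have h2 : x - f y ∈ K' := by
        change f (x - f y) = 0
        rw [map_sub, sub_eq_zero]
        exact hy.symm
      have h3 : f y ∈ J := ρ.sub_mem_modAug z y
      rw [← sub_add_cancel x (f y), add_comm]
      exact AddSubgroup.add_mem_sup h3 h2
    have h2 : ((F.comp F).range.comap F).index ≠ 0 := by
      rw [AddSubgroup.index_comap]; exact hrange.1
    have h3 : ((F.comp F).range.comap F).FiniteIndex := ⟨h2⟩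
    rw [← AddSubgroup.index_comap]
    exact AddSubgroup.index_antitone h1
  have e3 : J.index = J.relIndex K' * (J ⊔ K').index := by
    rw [← AddSubgroup.relIndex_sup_left, AddSubgroup.relIndex_mul_index le_sup_left]
  calc J.index ^ 2 = J.relIndex K' ^ 2 * (J ⊔ K').index ^ 2 := by rw [e3, mul_pow]
    _ ≤ ρ₁.modAug.index ^ 2 * ((F.comp F).range.relIndex F.range) ^ 2 := by gcongr
    _ ≤ p ^ (Module.finrank ℤ_[p] K + Module.finrank ℤ_[p] ρ₁.invariants) *
        p ^ Module.finrank ℤ_[p] (LinearMap.range f) := Nat.mul_le_mul hih hrange.2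
    _ ≤ _ := by
      rw [← pow_add]
      exact Nat.pow_le_pow_right (Fact.out : p.Prime).pos (by omega)

end Representation

/-! ### The elementary abelian quotient of a group -/

/-- The subgroup generated by the `p`-th powers and the commutators: the quotient by it is the
largest elementary abelian `p`-quotient. -/
def pFrattini (p : ℕ) (G : Type*) [Group G] : Subgroup G :=
  Subgroup.closure ({y | ∃ x, x ^ p = y} ∪ {y | ∃ a b, a * b * a⁻¹ * b⁻¹ = y})

section PFrattini

variable {p : ℕ} {G : Type*} [Group G]

theorem pow_mem_pFrattini (x : G) : x ^ p ∈ pFrattini p G :=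
  Subgroup.subset_closure (Or.inl ⟨x, rfl⟩)

theorem commutator_mem_pFrattini (a b : G) : a * b * a⁻¹ * b⁻¹ ∈ pFrattini p G :=
  Subgroup.subset_closure (Or.inr ⟨a, b, rfl⟩)

theorem pFrattini_le {K : Subgroup G} (h1 : ∀ x, x ^ p ∈ K)
    (h2 : ∀ a b, a * b * a⁻¹ * b⁻¹ ∈ K) : pFrattini p G ≤ K := by
  rw [pFrattini, Subgroup.closure_le]
  rintro _ (⟨x, rfl⟩ | ⟨a, b, rfl⟩)
  · exact h1 x
  · exact h2 a b

instance pFrattini_normal : (pFrattini p G).Normal where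
  conj_mem n hn g := by
    have h := mul_mem (commutator_mem_pFrattini (p := p) g n) hn
    rwa [inv_mul_cancel_right] at h

/-- In a finite `p`-group, `p`-th powers and commutators lie in every maximal subgroup. -/
theorem pFrattini_le_frattini [Fact p.Prime] [Finite G] (hG : IsPGroup p G) :
    pFrattini p G ≤ frattini G := by
  rw [frattini, Order.radical]
  refine le_iInf₂ fun K hK => ?_
  have hK : IsCoatom K := hK
  have hnil := hG.isNilpotent
  have hn : K.Normal :=
    Subgroup.NormalizerCondition.normal_of_coatom K Group.normalizerCondition_of_isNilpotent hK
  have hQ : IsPGroup p (G ⧸ K) := hG.to_quotient K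
  have hnt : Nontrivial (G ⧸ K) := QuotientGroup.nontrivial_iff.2 hK.1
  obtain ⟨c, hc⟩ := exists_prime_orderOf_dvd_card' (G := G ⧸ K) p
    (hQ.card_eq_or_dvd.resolve_left Finite.one_lt_card.ne')
  -- maximality of `K` makes the quotient cyclic, generated by an element of order `p`
  have htop : Subgroup.zpowers c = ⊤ := by
    have h1 : K ≤ (Subgroup.zpowers c).comap (QuotientGroup.mk' K) := by
      intro x hx
      rw [Subgroup.mem_comap, QuotientGroup.mk'_apply, (QuotientGroup.eq_one_iff x).2 hx]
      exact one_mem _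
    obtain ⟨g, rfl⟩ := QuotientGroup.mk_surjective c
    have hg : g ∉ K := fun hg => by
      rw [(QuotientGroup.eq_one_iff g).2 hg, orderOf_one] at hc
      exact (Fact.out : p.Prime).one_lt.ne hc
    have h2 : (Subgroup.zpowers (g : G ⧸ K)).comap (QuotientGroup.mk' K) = ⊤ := by
      refine (hK.le_iff.1 h1).resolve_right fun h => hg ?_
      rw [← h]
      exact Subgroup.mem_zpowers _
    rw [eq_top_iff]
    intro x _
    obtain ⟨y, rfl⟩ := QuotientGroup.mk_surjective x
    have : y ∈ (⊤ : Subgroup G) := trivial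
    rw [← h2] at this
    exact this
  have hz : ∀ x : G, ∃ k : ℤ, c ^ k = (x : G ⧸ K) := fun x =>
    Subgroup.mem_zpowers_iff.1 (htop ▸ Subgroup.mem_top (x : G ⧸ K))
  refine pFrattini_le (fun x => ?_) fun a b => ?_
  · obtain ⟨k, hk⟩ := hz x
    rw [← QuotientGroup.eq_one_iff, QuotientGroup.mk_pow, ← hk, ← zpow_natCast, ← zpow_mul,
      mul_comm, zpow_mul, zpow_natCast, orderOf_dvd_iff_pow_eq_one.1 hc.dvd, one_zpow]
  · obtain ⟨k, hk⟩ := hz a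
    obtain ⟨l, hl⟩ := hz b
    rw [← QuotientGroup.eq_one_iff]
    simp only [QuotientGroup.mk_mul, QuotientGroup.mk_inv]
    rw [← hk, ← hl, ← zpow_add, ← zpow_neg, ← zpow_add, ← zpow_neg, ← zpow_add]
    simp

/-- A finite elementary abelian `p`-group of order `p ^ d` is generated by `d` elements. -/
theorem exists_generators_of_nsmul_eq_zero (p : ℕ) [Fact p.Prime] (V : Type*) [AddCommGroup V]
    [Finite V] (hV : ∀ x : V, p • x = 0) :
    ∃ (d : ℕ) (b : Fin d → V), p ^ d = Nat.card V ∧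
      ∀ K : AddSubgroup V, (∀ i, b i ∈ K) → K = ⊤ := by
  have _inst : Module (ZMod p) V := AddCommGroup.zmodModule hV
  have : Module.Finite (ZMod p) V := Module.Finite.of_finite
  let b := Module.finBasis (ZMod p) V
  refine ⟨_, b, ?_, fun K hK => ?_⟩
  · rw [Module.natCard_eq_pow_finrank (K := ZMod p) (V := V), Nat.card_zmod]
  · have h1 : AddSubgroup.toZModSubmodule p K = ⊤ := by
      rw [eq_top_iff, ← b.span_eq, Submodule.span_le]
      rintro _ ⟨i, rfl⟩
      exact hK i
    rw [eq_top_iff]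
    intro x _
    exact (h1 ▸ Submodule.mem_top : x ∈ AddSubgroup.toZModSubmodule p K)

/-- The half of the Burnside basis theorem bounding `d(G)`: lifts of generators of the largest
elementary abelian quotient generate `G`. -/
theorem pow_rank_le_index_pFrattini [Fact p.Prime] [Finite G] (hG : IsPGroup p G) :
    p ^ Group.rank G ≤ (pFrattini p G).index := by
  classical
  let Q := G ⧸ pFrattini p G
  let _ : CommGroup Q :=
    { (inferInstance : Group Q) with
      mul_comm := by
        intro x y
        obtain ⟨a, rfl⟩ := QuotientGroup.mk_surjective x
        obtain ⟨b, rfl⟩ := QuotientGroup.mk_surjective y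
        rw [← mul_inv_eq_one, mul_inv_rev, ← mul_assoc]
        exact (QuotientGroup.eq_one_iff _).2 (commutator_mem_pFrattini a b) }
  obtain ⟨d, b, hd, hb⟩ := exists_generators_of_nsmul_eq_zero p (Additive Q) (by
    intro x
    obtain ⟨a, ha⟩ := QuotientGroup.mk_surjective (Additive.toMul x)
    apply Additive.toMul.injective
    rw [toMul_nsmul, ← ha]
    exact (QuotientGroup.eq_one_iff _).2 (pow_mem_pFrattini a))
  have hcard : (pFrattini p G).index = p ^ d := hd.symm
  choose g hg using fun i => QuotientGroup.mk_surjective (s := pFrattini p G) (b i).toMul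
  set S : Finset G := Finset.univ.image g
  have hS : Subgroup.closure (S : Set G) = ⊤ := by
    apply frattini_nongenerating
    rw [eq_top_iff]
    set K := Subgroup.closure (S : Set G)
    have h1 := hb (Subgroup.toAddSubgroup (K.map (QuotientGroup.mk' (pFrattini p G))))
      fun i => ⟨g i, Subgroup.subset_closure (by simp [S]), hg i⟩
    intro x _
    have h2 : (Additive.ofMul (x : Q)) ∈ (⊤ : AddSubgroup (Additive Q)) := trivial
    rw [← h1] at h2
    obtain ⟨y, hy, hyx⟩ := h2
    have h3 : y⁻¹ * x ∈ pFrattini p G := QuotientGroup.eq.1 hyx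
    rw [← mul_inv_cancel_left y x]
    exact Subgroup.mul_mem_sup hy (pFrattini_le_frattini hG h3)
  rw [hcard]
  refine Nat.pow_le_pow_right (Fact.out : p.Prime).pos ((Group.rank_le hS).trans ?_)
  exact Finset.card_image_le.trans (by simp)

/-- The kernel of the map between the elementary abelian quotients of `G` and `G ⧸ A` is the image
of `A`. -/
theorem index_pFrattini_eq (A : Subgroup G) [A.Normal] :
    (pFrattini p G).index = (pFrattini p G).relIndex A * (pFrattini p (G ⧸ A)).index := by
  have h1 : (pFrattini p (G ⧸ A)).comap (QuotientGroup.mk' A) = pFrattini p G ⊔ A := by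
    apply le_antisymm
    · have h2 := Subgroup.comap_map_eq (QuotientGroup.mk' A) (pFrattini p G)
      rw [QuotientGroup.ker_mk'] at h2
      rw [← h2]
      apply Subgroup.comap_mono
      refine pFrattini_le (fun x => ?_) fun a b => ?_
      · obtain ⟨y, rfl⟩ := QuotientGroup.mk_surjective x
        exact ⟨_, pow_mem_pFrattini y, rfl⟩
      · obtain ⟨a, rfl⟩ := QuotientGroup.mk_surjective a
        obtain ⟨b, rfl⟩ := QuotientGroup.mk_surjective b
        exact ⟨_, commutator_mem_pFrattini a b, rfl⟩
    · refine sup_le (pFrattini_le (fun x => ?_) fun a b => ?_) fun a ha => ?_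
      · exact pow_mem_pFrattini (x : G ⧸ A)
      · exact commutator_mem_pFrattini (a : G ⧸ A) (b : G ⧸ A)
      · rw [Subgroup.mem_comap, QuotientGroup.mk'_apply, (QuotientGroup.eq_one_iff a).2 ha]
        exact one_mem _
  rw [← Subgroup.index_comap_of_surjective _ (QuotientGroup.mk'_surjective A), h1,
    ← Subgroup.relIndex_sup_left, Subgroup.relIndex_mul_index le_sup_left]

end PFrattini

/-! ### Self-centralizing abelian normal subgroups -/

/-- A nontrivial normal subgroup of a finite `p`-group meets the centre nontrivially. -/
theorem IsPGroup.exists_ne_one_mem_center {p : ℕ} [Fact p.Prime] {G : Type*} [Group G] [Finite G]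
    (hG : IsPGroup p G) (N : Subgroup G) [N.Normal] (hN : N ≠ ⊥) :
    ∃ c ∈ N, c ≠ 1 ∧ c ∈ Subgroup.center G := by
  let _ : MulAction G N := MulAction.compHom N (MulAut.conjNormal (H := N))
  have hsm : ∀ (g : G) (n : N), ((g • n : N) : G) = g * n * g⁻¹ := fun g n =>
    MulAut.conjNormal_apply g n
  have hnt : Nontrivial N := (Subgroup.nontrivial_iff_ne_bot N).2 hN
  have hd : p ∣ Nat.card N :=
    (hG.to_subgroup N).card_eq_or_dvd.resolve_left Finite.one_lt_card.ne'
  obtain ⟨c, hc, hc1⟩ := hG.exists_fixed_point_of_prime_dvd_card_of_fixed_point N hd (a := 1)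
    (fun g => Subtype.ext (by rw [hsm]; simp))
  refine ⟨c, c.2, fun h => hc1 (Subtype.ext h.symm), ?_⟩
  rw [Subgroup.mem_center_iff]
  intro g
  have h := congrArg Subtype.val (hc g)
  rw [hsm] at h
  exact mul_inv_eq_iff_eq_mul.1 h

/-- A maximal abelian normal subgroup of a finite `p`-group contains its centralizer. -/
theorem IsPGroup.exists_normal_abelian_centralizer_le {p : ℕ} [Fact p.Prime] {G : Type*} [Group G]
    [Finite G] (hG : IsPGroup p G) :
    ∃ A : Subgroup G, A.Normal ∧ (∀ a ∈ A, ∀ b ∈ A, a * b = b * a) ∧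
      ∀ g, (∀ a ∈ A, g * a = a * g) → g ∈ A := by
  obtain ⟨A, hA⟩ := Set.Finite.exists_maximal
    (s := {A : Subgroup G | A.Normal ∧ ∀ a ∈ A, ∀ b ∈ A, a * b = b * a}) (Set.toFinite _)
    ⟨⊥, inferInstance, by simp⟩
  obtain ⟨⟨hAn, hAc⟩, hmax⟩ := hA
  refine ⟨A, hAn, hAc, ?_⟩
  by_contra! hcon
  obtain ⟨g₀, hg₀, hg₀A⟩ := hcon
  set C := Subgroup.centralizer (A : Set G)
  have hCn : C.Normal := inferInstance
  have hN : C.map (QuotientGroup.mk' A) ≠ ⊥ := by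
    intro h
    rw [Subgroup.map_eq_bot_iff, QuotientGroup.ker_mk'] at h
    exact hg₀A (h (Subgroup.mem_centralizer_iff.2 fun a ha => (hg₀ a ha).symm))
  have : (C.map (QuotientGroup.mk' A)).Normal := hCn.map _ (QuotientGroup.mk'_surjective A)
  obtain ⟨_, ⟨x, hx, rfl⟩, hc1, hcc⟩ :=
    (hG.to_quotient A).exists_ne_one_mem_center (C.map (QuotientGroup.mk' A)) hN
  rw [QuotientGroup.mk'_apply] at hc1 hcc
  have hxA : ∀ a ∈ A, x * a = a * x := fun a ha => (Subgroup.mem_centralizer_iff.1 hx a ha).symm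
  -- `A` and `x` generate a larger abelian normal subgroup
  set B := (Subgroup.zpowers (x : G ⧸ A)).comap (QuotientGroup.mk' A)
  have hzn : (Subgroup.zpowers (x : G ⧸ A)).Normal :=
    ⟨fun n hn g => by
      have h1 := Subgroup.mem_center_iff.1 ((Subgroup.zpowers_le.2 hcc) hn) g
      rwa [h1, mul_inv_cancel_right]⟩
  have hB : ∀ b ∈ B, ∃ k : ℤ, ∃ a ∈ A, b = x ^ k * a := by
    rintro b hb
    obtain ⟨k, hk⟩ := Subgroup.mem_zpowers_iff.1 (Subgroup.mem_comap.1 hb)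
    refine ⟨k, (x ^ k)⁻¹ * b, QuotientGroup.eq.1 ?_, by group⟩
    rw [QuotientGroup.mk_zpow]
    exact hk
  have hAB : A ≤ B := by
    intro a ha
    rw [Subgroup.mem_comap, QuotientGroup.mk'_apply, (QuotientGroup.eq_one_iff a).2 ha]
    exact one_mem _
  have hBA : B ≤ A := by
    refine hmax ⟨hzn.comap _, fun b hb b' hb' => ?_⟩ hAB
    obtain ⟨k, a, ha, rfl⟩ := hB b hb
    obtain ⟨l, a', ha', rfl⟩ := hB b' hb'
    have c1 : ∀ a ∈ A, ∀ k : ℤ, Commute (x ^ k) a := fun a ha k =>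
      Commute.zpow_left (hxA a ha) k
    have c2 : Commute a a' := hAc a ha a' ha'
    exact ((((Commute.refl x).zpow_zpow k l).mul_right (c1 a' ha' k)).mul_left
      ((c1 a ha l).symm.mul_right c2)).eq
  refine hc1 ((QuotientGroup.eq_one_iff x).2 (hBA ?_))
  exact Subgroup.mem_zpowers (x : G ⧸ A)

/-! ### Generators of modules over the group ring -/

/-- Nakayama's lemma for the group ring of a finite `p`-group over the `p`-adic integers. -/
theorem eq_top_of_sup_modAug_eq_top {p : ℕ} [Fact p.Prime] {G : Type*} [Group G] [Finite G]
    (hG : IsPGroup p G) {M : Type*} [AddCommGroup M] [Module ℤ_[p] M]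
    [Module (MonoidAlgebra ℤ_[p] G) M] [IsScalarTower ℤ_[p] (MonoidAlgebra ℤ_[p] G) M]
    [Module.Free ℤ_[p] M] [Module.Finite ℤ_[p] M] (N : Submodule (MonoidAlgebra ℤ_[p] G) M)
    (hN : N.toAddSubgroup ⊔ (Representation.ofModule' (k := ℤ_[p]) (G := G) M).modAug = ⊤) :
    N = ⊤ := by
  have hρ : ∀ (g : G) (x : M), Representation.ofModule' (k := ℤ_[p]) (G := G) M g x =
      MonoidAlgebra.of ℤ_[p] G g • x := fun g x => by
    simp [Representation.ofModule', MonoidAlgebra.lift_symm_apply]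
  have : Module.Finite (MonoidAlgebra ℤ_[p] G) M :=
    Module.Finite.of_restrictScalars_finite ℤ_[p] _ _
  by_contra hne
  obtain ⟨N', hN', hle⟩ := (eq_top_or_exists_le_coatom N).resolve_left hne
  apply hN'.1
  -- a `G`-stable subspace strictly larger than the maximal submodule `N'` is everything
  have hext : ∀ W : Submodule ℤ_[p] M,
      (∀ (g : G) (v : M), v ∈ W → MonoidAlgebra.of ℤ_[p] G g • v ∈ W) →
      (∀ x ∈ N', x ∈ W) → (∃ x ∈ W, x ∉ N') → ∀ x, x ∈ W := by
    rintro W hW h1 ⟨x, hxW, hx⟩ y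
    let W' := MonoidAlgebra.submoduleOfSMulMem W hW
    have h2 : W' = ⊤ := (hN'.le_iff.1 (show N' ≤ W' from h1)).resolve_right
      fun h => hx (h ▸ (show x ∈ W' from hxW))
    exact (h2 ▸ Submodule.mem_top : y ∈ W')
  have hcomm : ∀ (a : MonoidAlgebra ℤ_[p] G) (x : M), a • (p • x) = p • (a • x) :=
    fun a x => map_nsmul (DistribSMul.toAddMonoidHom M a) p x
  -- `p` kills the simple quotient, by Nakayama's lemma over `ℤ_[p]`
  have hpN : ∀ x : M, p • x ∈ N' := by
    by_contra! hcon
    obtain ⟨x₀, hx₀⟩ := hcon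
    let P : Submodule ℤ_[p] M := Ideal.span {(p : ℤ_[p])} • ⊤
    have hP : ∀ y, y ∈ P ↔ ∃ x, p • x = y := fun y => by
      simp [P, Submodule.ideal_span_singleton_smul, Submodule.mem_smul_pointwise_iff_exists,
        Nat.cast_smul_eq_nsmul]
    have h1 := hext (N'.restrictScalars ℤ_[p] ⊔ P) (by
      intro g v hv
      obtain ⟨a, ha, b, hb, rfl⟩ := Submodule.mem_sup.1 hv
      obtain ⟨c, rfl⟩ := (hP b).1 hb
      rw [smul_add, hcomm]
      exact Submodule.add_mem_sup (N'.smul_mem _ ha) ((hP _).2 ⟨_, rfl⟩))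
      (fun x hx => Submodule.mem_sup_left hx)
      ⟨p • x₀, Submodule.mem_sup_right ((hP _).2 ⟨_, rfl⟩), hx₀⟩
    have h2 : (⊤ : Submodule ℤ_[p] M) ≤ N'.restrictScalars ℤ_[p] := by
      refine Submodule.le_of_le_smul_of_le_jacobson_bot (I := Ideal.span {(p : ℤ_[p])})
        Module.Finite.fg_top ?_ fun x _ => h1 x
      rw [IsLocalRing.jacobson_eq_maximalIdeal _ bot_ne_top, PadicInt.maximalIdeal_eq_span_p]
    exact hx₀ (h2 (Submodule.mem_top (x := p • x₀)))
  have hindex : N'.toAddSubgroup.index ∣ p ^ Module.finrank ℤ_[p] M := by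
    rw [← index_range_nsmul_prime p M]
    apply AddSubgroup.index_dvd_of_le
    rintro _ ⟨x, rfl⟩
    exact hpN x
  have hindex1 : N'.toAddSubgroup.index ≠ 1 := by
    rw [Ne, AddSubgroup.index_eq_one]
    intro h
    apply hN'.1
    rw [eq_top_iff]
    intro x _
    exact (h ▸ AddSubgroup.mem_top x : x ∈ N'.toAddSubgroup)
  have hpdvd : p ∣ Nat.card (M ⧸ N') := by
    obtain ⟨k, -, hk⟩ := (Nat.dvd_prime_pow (Fact.out : p.Prime)).1 hindex
    change p ∣ N'.toAddSubgroup.index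
    rw [hk] at hindex1 ⊢
    exact dvd_pow_self p fun h => hindex1 (by rw [h, pow_zero])
  have : Finite (M ⧸ N') := by
    apply Nat.finite_of_card_ne_zero
    exact ne_zero_of_dvd_ne_zero (pow_ne_zero _ (Fact.out : p.Prime).ne_zero) hindex
  let _ : MulAction G (M ⧸ N') := MulAction.compHom _ (MonoidAlgebra.of ℤ_[p] G)
  obtain ⟨c, hc, hc0⟩ := hG.exists_fixed_point_of_prime_dvd_card_of_fixed_point (M ⧸ N') hpdvd
    (a := 0) (fun g => smul_zero (MonoidAlgebra.of ℤ_[p] G g))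
  obtain ⟨x₀, rfl⟩ := Submodule.Quotient.mk_surjective N' c
  -- the vectors fixed modulo `N'` form a submodule, so by maximality the quotient is trivial
  let W : Submodule ℤ_[p] M :=
    { carrier := {x | ∀ g, MonoidAlgebra.of ℤ_[p] G g • x - x ∈ N'}
      add_mem' := fun {x y} hx hy g => by
        rw [smul_add, add_sub_add_comm]; exact add_mem (hx g) (hy g)
      zero_mem' := fun g => by rw [smul_zero, sub_zero]; exact zero_mem _
      smul_mem' := fun r x hx g => by
        rw [← hρ, map_smul, hρ, ← smul_sub]
        exact (N'.restrictScalars ℤ_[p]).smul_mem r (hx g) }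
  have hW := hext W
    (fun g v hv h => by
      have h1 := N'.smul_mem (MonoidAlgebra.of ℤ_[p] G g) (hv (g⁻¹ * h * g))
      rw [smul_sub, ← mul_smul, ← map_mul] at h1
      rwa [← mul_smul, ← map_mul, show h * g = g * (g⁻¹ * h * g) by group])
    (fun x hx g => sub_mem (N'.smul_mem _ hx) hx)
    ⟨x₀, fun g => (Submodule.Quotient.eq N').1 (hc g), fun h =>
      hc0 ((Submodule.Quotient.mk_eq_zero N').2 h).symm⟩
  have hJ : N'.toAddSubgroup = ⊤ := by
    rw [eq_top_iff, ← hN]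
    refine sup_le (fun x hx => hle hx) (Representation.modAug_le _ hpN fun g x => ?_)
    rw [hρ]
    exact hW x g
  rw [eq_top_iff]
  intro x _
  exact (hJ ▸ AddSubgroup.mem_top x : x ∈ N'.toAddSubgroup)

/-- Lifts of generators of the coinvariants modulo `p` generate the module. -/
theorem exists_spanRank_le_and_pow_eq_index_modAug {p : ℕ} [Fact p.Prime] {G : Type*} [Group G]
    [Finite G] (hG : IsPGroup p G) {M : Type*} [AddCommGroup M] [Module ℤ_[p] M]
    [Module (MonoidAlgebra ℤ_[p] G) M] [IsScalarTower ℤ_[p] (MonoidAlgebra ℤ_[p] G) M]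
    [Module.Free ℤ_[p] M] [Module.Finite ℤ_[p] M] :
    ∃ d : ℕ, (⊤ : Submodule (MonoidAlgebra ℤ_[p] G) M).spanRank ≤ d ∧
      p ^ d = (Representation.ofModule' (k := ℤ_[p]) (G := G) M).modAug.index := by
  classical
  set J := (Representation.ofModule' (k := ℤ_[p]) (G := G) M).modAug
  have : Finite (M ⧸ J) := Nat.finite_of_card_ne_zero (Representation.modAug_index_ne_zero _)
  obtain ⟨d, b, hd, hb⟩ := exists_generators_of_nsmul_eq_zero p (M ⧸ J) (by
    intro x
    obtain ⟨a, rfl⟩ := QuotientAddGroup.mk_surjective x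
    exact (QuotientAddGroup.eq_zero_iff _).2 (Representation.nsmul_mem_modAug _ a))
  choose g hg using fun i => QuotientAddGroup.mk_surjective (s := J) (b i)
  refine ⟨d, ?_, hd⟩
  · have hspan : Submodule.span (MonoidAlgebra ℤ_[p] G) (Set.range g) = ⊤ := by
      apply eq_top_of_sup_modAug_eq_top hG
      set N := Submodule.span (MonoidAlgebra ℤ_[p] G) (Set.range g)
      have h1 := hb (N.toAddSubgroup.map (QuotientAddGroup.mk' J))
        fun i => ⟨g i, Submodule.subset_span ⟨i, rfl⟩, hg i⟩
      rw [eq_top_iff]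
      intro x _
      have h2 : (x : M ⧸ J) ∈ (⊤ : AddSubgroup (M ⧸ J)) := trivial
      rw [← h1] at h2
      obtain ⟨y, hy, hyx⟩ := h2
      have h3 : -y + x ∈ J := QuotientAddGroup.eq.1 hyx
      rw [← add_neg_cancel_left y x]
      exact AddSubgroup.add_mem_sup hy h3
    rw [← hspan]
    refine (Submodule.spanRank_span_le_card _).trans ?_
    have h := Cardinal.mk_range_le_lift (f := g)
    simpa using h

/-! ### The lattice of odd logarithms of a finite abelian group -/

/-- A finite set of characters `ch i` of an abelian normal subgroup `A` of `G`, stable under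
conjugation and without fixed points under inversion, which separates the elements of `A`. The
values lie in a group `T` with an exponential `e : ℤ_[p] → T` through which all characters can
be lifted. -/
structure OddCharacterFamily (p : ℕ) [Fact p.Prime] {G : Type*} [Group G] (A : Subgroup G)
    [A.Normal] (T I : Type*) [CommGroup T] [MulAction G I] where
  /-- the exponential -/
  e : Multiplicative ℤ_[p] →* T
  /-- multiplication of an exponent by a scalar raises the exponential to a power -/
  e_mul : ∀ r : ℤ_[p], ∃ m : ℕ, ∀ y : ℤ_[p], e (.ofAdd (r * y)) = e (.ofAdd y) ^ m
  /-- the characters -/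
  ch : I → A →* T
  /-- inversion -/
  inv : I → I
  inv_inv : ∀ i, inv (inv i) = i
  inv_ne : ∀ i, inv i ≠ i
  inv_smul : ∀ (g : G) i, inv (g • i) = g • inv i
  ch_inv : ∀ i a, ch (inv i) a = (ch i a)⁻¹
  ch_smul : ∀ (g : G) i a, ch (g • i) a = ch i (MulAut.conjNormal g⁻¹ a)
  smul_eq : ∀ a ∈ A, ∀ i : I, a • i = i
  separates : ∀ a, (∀ i, ch i a = 1) → a = 1
  exists_log : ∀ i a, ∃ y, e (.ofAdd y) = ch i a

namespace OddCharacterFamily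

variable {p : ℕ} [Fact p.Prime] {G : Type*} [Group G] {A : Subgroup G} [A.Normal]
  {T I : Type*} [CommGroup T] [MulAction G I] (D : OddCharacterFamily p A T I)

/-- The odd functions `y` on the family such that, for some `a ∈ A`, each `y i` is a logarithm of
`ch i a`. -/
def lattice : Submodule ℤ_[p] (I → ℤ_[p]) where
  carrier := {y | (∀ i, y (D.inv i) = -y i) ∧ ∃ a, ∀ i, D.e (.ofAdd (y i)) = D.ch i a}
  add_mem' := by
    rintro y z ⟨hy, a, ha⟩ ⟨hz, b, hb⟩
    refine ⟨fun i => ?_, a * b, fun i => ?_⟩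
    · rw [Pi.add_apply, Pi.add_apply, hy, hz]; ring
    · rw [Pi.add_apply, ofAdd_add, map_mul, ha, hb, map_mul]
  zero_mem' := ⟨fun i => by simp, 1, fun i => by simp⟩
  smul_mem' := by
    rintro r y ⟨hy, a, ha⟩
    obtain ⟨m, hm⟩ := D.e_mul r
    refine ⟨fun i => ?_, a ^ m, fun i => ?_⟩
    · simp [hy]
    · rw [Pi.smul_apply, smul_eq_mul, hm, ha, map_pow]

/-- The element of `A` whose logarithm is given. -/
noncomputable def exp (y : D.lattice) : A := y.2.2.choose

theorem e_apply (y : D.lattice) (i : I) : D.e (.ofAdd (y.1 i)) = D.ch i (D.exp y) :=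
  y.2.2.choose_spec i

theorem exp_eq {y : D.lattice} {a : A} (h : ∀ i, D.e (.ofAdd (y.1 i)) = D.ch i a) :
    D.exp y = a := by
  rw [← mul_inv_eq_one]
  apply D.separates
  intro i
  rw [map_mul, map_inv, ← D.e_apply, h, mul_inv_cancel]

theorem exp_add (y z : D.lattice) : D.exp (y + z) = D.exp y * D.exp z := by
  apply D.exp_eq
  intro i
  rw [map_mul, ← D.e_apply, ← D.e_apply, ← map_mul, ← ofAdd_add]
  rfl

theorem exp_surjective (hp : Odd p) : Function.Surjective D.exp := by
  intro a
  choose m hm using fun i => D.exists_log i a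
  have h2 : IsUnit (2 : ℤ_[p]) := by
    have h := (PadicInt.isUnit_iff (p := p) (z := ((2 : ℕ) : ℤ_[p]))).2
      (by
        rw [PadicInt.norm_natCast_eq_one_iff]
        exact (Nat.coprime_comm.1 hp.coprime_two_left))
    exact_mod_cast h
  obtain ⟨u, hu⟩ := h2.exists_left_inv
  obtain ⟨k, hk⟩ := D.e_mul u
  -- halving the difference of logarithms of `ch i a` and of its inverse gives an odd logarithm
  have key : ∀ i, D.e (.ofAdd (u * (m i - m (D.inv i)))) = D.ch i a := by
    intro i
    have h1 : D.e (.ofAdd (m i - m (D.inv i))) = D.e (.ofAdd (2 * m i)) := by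
      rw [sub_eq_add_neg, two_mul, ofAdd_add, ofAdd_add, map_mul, map_mul, ofAdd_neg, map_inv, hm,
        hm, D.ch_inv, _root_.inv_inv]
    rw [hk, h1, ← hk, ← mul_assoc, hu, one_mul, hm]
  refine ⟨⟨fun i => u * (m i - m (D.inv i)), fun i => ?_, a, key⟩, D.exp_eq key⟩
  change u * (m (D.inv i) - m (D.inv (D.inv i))) = -(u * (m i - m (D.inv i)))
  rw [D.inv_inv]
  ring

/-- The permutation representation of `G` on functions on the family. -/
noncomputable def permRep : Representation ℤ_[p] G (I → ℤ_[p]) where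
  toFun g := LinearMap.funLeft ℤ_[p] ℤ_[p] (fun i => g⁻¹ • i)
  map_one' := by ext; simp
  map_mul' g h := by
    apply LinearMap.ext
    intro y
    funext i
    simp [LinearMap.funLeft_apply, mul_smul]

/-- The action of `G` on the lattice. -/
noncomputable def rep : Representation ℤ_[p] G D.lattice :=
  (permRep (p := p) (G := G) (I := I)).subrepresentation D.lattice (by
    rintro g y ⟨hy, a, ha⟩
    refine ⟨fun i => ?_, MulAut.conjNormal g a, fun i => ?_⟩
    · change y (g⁻¹ • D.inv i) = -y (g⁻¹ • i)
      rw [← D.inv_smul, hy]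
    · change D.e (.ofAdd (y (g⁻¹ • i))) = _
      rw [ha, D.ch_smul, _root_.inv_inv])

theorem rep_apply (g : G) (y : D.lattice) (i : I) : (D.rep g y).1 i = y.1 (g⁻¹ • i) := rfl

theorem exp_rep (g : G) (y : D.lattice) : D.exp (D.rep g y) = MulAut.conjNormal g (D.exp y) := by
  apply D.exp_eq
  intro i
  rw [rep_apply, D.e_apply, D.ch_smul, _root_.inv_inv]

/-- The action of `G ⧸ A` on the lattice. -/
noncomputable def quotientRep : Representation ℤ_[p] (G ⧸ A) D.lattice :=
  QuotientGroup.lift A D.rep (by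
    intro a ha
    apply LinearMap.ext
    intro y
    apply Subtype.ext
    funext i
    rw [rep_apply, D.smul_eq _ (inv_mem ha)]
    rfl)

theorem quotientRep_mk (g : G) (y : D.lattice) : D.quotientRep g y = D.rep g y := rfl

theorem quotientRep_faithful (hp : Odd p) (hA : ∀ g, (∀ a ∈ A, g * a = a * g) → g ∈ A) (g : G ⧸ A)
    (hg : ∀ y, D.quotientRep g y = y) : g = 1 := by
  obtain ⟨g, rfl⟩ := QuotientGroup.mk_surjective g
  refine (QuotientGroup.eq_one_iff g).2 (hA g fun a ha => ?_)
  obtain ⟨y, hy⟩ := D.exp_surjective hp ⟨a, ha⟩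
  have h1 := D.exp_rep g y
  rw [← quotientRep_mk, hg, hy] at h1
  have h2 : a = g * a * g⁻¹ := congrArg Subtype.val h1
  exact (mul_inv_eq_iff_eq_mul.1 h2.symm)

/-- The elementary abelian quotient of `A` of `G`-coinvariants is a quotient of that of the
lattice. -/
theorem relIndex_pFrattini_le [Finite I] (hp : Odd p) :
    (pFrattini p G).relIndex A ≤ D.quotientRep.modAug.index := by
  let ψ : D.lattice →+ Additive A := AddMonoidHom.mk' (fun y => .ofMul (D.exp y)) D.exp_add
  let K : AddSubgroup (Additive A) := Subgroup.toAddSubgroup ((pFrattini p G).subgroupOf A)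
  have hψ : Function.Surjective ψ := fun a => D.exp_surjective hp a.toMul
  have h1 : D.quotientRep.modAug ≤ K.comap ψ := by
    refine Representation.modAug_le _ (fun y => ?_) fun g y => ?_
    · rw [AddSubgroup.mem_comap, map_nsmul]
      exact pow_mem_pFrattini (p := p) (D.exp y : G)
    · obtain ⟨g, rfl⟩ := QuotientGroup.mk_surjective g
      rw [AddSubgroup.mem_comap, map_sub, quotientRep_mk]
      have h2 : (D.exp (D.rep g y) : G) / D.exp y ∈ pFrattini p G := by
        rw [exp_rep, div_eq_mul_inv]
        exact commutator_mem_pFrattini g (D.exp y : G)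
      exact h2
  have h2 : D.quotientRep.modAug.FiniteIndex := ⟨Representation.modAug_index_ne_zero _⟩
  have h3 := AddSubgroup.index_antitone h1
  rw [AddSubgroup.index_comap_of_surjective K hψ] at h3
  exact h3

/-- An odd function is determined by its values on half of the family. -/
theorem two_mul_finrank_lattice_le [Finite I] :
    2 * Module.finrank ℤ_[p] D.lattice ≤ Nat.card I := by
  classical
  have := Fintype.ofFinite I
  let f := Fintype.equivFin I
  -- a linear order picks one element from each pair `{i, inv i}`
  let S : Finset I := Finset.univ.filter fun i => f i < f (D.inv i)
  let r : D.lattice →ₗ[ℤ_[p]] (S → ℤ_[p]) :=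
    (LinearMap.funLeft ℤ_[p] ℤ_[p] (Subtype.val : S → I)).comp D.lattice.subtype
  have hr : Function.Injective r := by
    rw [← LinearMap.ker_eq_bot, LinearMap.ker_eq_bot']
    intro y hy
    have h1 : ∀ i, f i < f (D.inv i) → y.1 i = 0 := fun i hi =>
      congrFun hy ⟨i, by simpa [S] using hi⟩
    apply Subtype.ext
    funext i
    rcases lt_trichotomy (f i) (f (D.inv i)) with h | h | h
    · exact h1 i h
    · exact absurd (f.injective h).symm (D.inv_ne i)
    · have h2 := h1 (D.inv i) (by rwa [D.inv_inv])
      rw [y.2.1] at h2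
      exact neg_eq_zero.1 h2
  have h1 := LinearMap.finrank_le_finrank_of_injective hr
  rw [Module.finrank_pi, Fintype.card_coe] at h1
  have hinj : Function.Injective D.inv := Function.LeftInverse.injective D.inv_inv
  have hdisj : Disjoint S (S.image D.inv) := by
    rw [Finset.disjoint_left]
    intro i hi hi'
    obtain ⟨j, hj, rfl⟩ := Finset.mem_image.1 hi'
    simp only [S, Finset.mem_filter, Finset.mem_univ, true_and, D.inv_inv] at hi hj
    exact lt_asymm hi hj
  have h2 := Finset.card_le_univ (S ∪ S.image D.inv)
  rw [Finset.card_union_of_disjoint hdisj, Finset.card_image_of_injective _ hinj] at h2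
  rw [Nat.card_eq_fintype_card]
  omega

end OddCharacterFamily

/-! ### Weight spaces of abelian `p`-groups -/

open scoped TensorProduct

/-- The independent subspaces of a finite-dimensional space have dimensions of sum at most that of
the space. -/
theorem iSupIndep.sum_finrank_le {K V ι : Type*} [Field K] [AddCommGroup V] [Module K V]
    [FiniteDimensional K V] [Fintype ι] {W : ι → Submodule K V} (h : iSupIndep W) :
    ∑ i, Module.finrank K (W i) ≤ Module.finrank K V := by
  classical
  have h1 := LinearMap.finrank_le_finrank_of_injective (f := DirectSum.coeLinearMap W)
    h.dfinsupp_lsum_injective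
  rwa [Module.finrank_directSum] at h1

section WeightSpace

variable {R C A M : Type*} [CommRing R] [Field C] [Algebra R C] [Group A] [AddCommGroup M]
  [Module R M] (τ : Representation R A M)

/-- The eigenspace of a character of a group in the scalar extension of a
representation. -/
def weightSpace (χ : A →* Cˣ) : Submodule C (C ⊗[R] M) where
  carrier := {v | ∀ a, (τ a).baseChange C v = (χ a : C) • v}
  add_mem' := fun {v w} hv hw a => by rw [map_add, hv, hw, smul_add]
  zero_mem' := fun a => by rw [map_zero, smul_zero]
  smul_mem' := fun c v hv a => by rw [map_smul, hv, smul_comm]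

variable {τ} {χ : A →* Cˣ}

theorem baseChange_rep_mul (a b : A) (v : C ⊗[R] M) :
    (τ (a * b)).baseChange C v = (τ a).baseChange C ((τ b).baseChange C v) := by
  rw [map_mul, Module.End.mul_eq_comp, LinearMap.baseChange_comp]
  rfl

variable (τ)

theorem iSupIndep_weightSpace [IsMulCommutative A] : iSupIndep (fun χ : A →* Cˣ => weightSpace τ χ) := by
  let f : A → Module.End C (C ⊗[R] M) := fun a => (τ a).baseChange C
  have hcomm : ∀ a b, Commute (f a) (f b) := fun a b => by
    apply LinearMap.ext
    intro v
    rw [Module.End.mul_apply, Module.End.mul_apply, ← baseChange_rep_mul, ← baseChange_rep_mul,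
      mul_comm']
  have h1 := Module.End.independent_iInf_maxGenEigenspace_of_forall_mapsTo f fun a b c =>
    Module.End.mapsTo_maxGenEigenspace_of_comm (hcomm b a) c
  have hinj : Function.Injective (fun (χ : A →* Cˣ) (a : A) => (χ a : C)) := by
    intro χ ψ h
    ext a
    exact congrFun h a
  refine (h1.comp hinj).mono fun χ v hv => ?_
  rw [Function.comp_apply, Submodule.mem_iInf]
  intro a
  exact Module.End.mem_maxGenEigenspace _ _ _ |>.2 ⟨1, by
    rw [pow_one, LinearMap.sub_apply, LinearMap.smul_apply, Module.End.one_apply, sub_eq_zero]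
    exact hv a⟩

theorem finrank_invariants_le [IsDomain R] [IsPrincipalIdealRing R] [Module.Free R M]
    [Module.Finite R M] [Module.IsTorsionFree R C] :
    Module.finrank R τ.invariants ≤ Module.finrank C (weightSpace τ (1 : A →* Cˣ)) := by
  let j : C ⊗[R] τ.invariants →ₗ[C] C ⊗[R] M := τ.invariants.subtype.baseChange C
  have hj : Function.Injective j :=
    Module.Flat.lTensor_preserves_injective_linearMap (M := C) _ τ.invariants.subtype_injective
  have hmem : ∀ v, j v ∈ weightSpace τ (1 : A →* Cˣ) := by
    intro v a
    induction v using TensorProduct.induction_on with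
    | zero => simp
    | tmul c m =>
      have h1 : τ a m = m := m.2 a
      simp [j, LinearMap.baseChange_tmul, h1]
    | add v w hv hw => rw [map_add, map_add, hv, hw, smul_add]
  have h1 := LinearMap.finrank_le_finrank_of_injective (f := j.codRestrict _ hmem)
    fun v w h => hj (congrArg Subtype.val h)
  rwa [Module.finrank_baseChange] at h1

/-- An automorphism of the coefficients inverting the values of `χ` exchanges the weight spaces of
`χ` and `χ⁻¹`. -/
theorem weightSpace_inv_ne_bot (σ : C ≃ₐ[R] C) (hσ : ∀ a, σ (χ a) = ((χ a)⁻¹ : Cˣ))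
    (h : weightSpace τ χ ≠ ⊥) : weightSpace τ χ⁻¹ ≠ ⊥ := by
  obtain ⟨v, hv, hv0⟩ := Submodule.exists_mem_ne_zero_of_ne_bot h
  let s := LinearEquiv.rTensor M σ.toLinearEquiv
  have h1 : ∀ (f : M →ₗ[R] M) (v : C ⊗[R] M), s (f.baseChange C v) = f.baseChange C (s v) := by
    intro f v
    induction v using TensorProduct.induction_on with
    | zero => simp
    | tmul c m => simp [s]
    | add v w hv hw => rw [map_add, map_add, hv, hw, map_add, map_add]
  have h2 : ∀ (c : C) (v : C ⊗[R] M), s (c • v) = σ c • s v := by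
    intro c v
    induction v using TensorProduct.induction_on with
    | zero => simp
    | tmul d m => simp [s, TensorProduct.smul_tmul']
    | add v w hv hw => rw [smul_add, map_add, map_add, hv, hw, smul_add]
  refine (Submodule.ne_bot_iff _).2 ⟨s v, fun a => ?_, (map_ne_zero_iff s s.injective).2 hv0⟩
  rw [← h1, hv a, h2, hσ]
  rfl

/-- The characters of a finite abelian group occurring in a faithful representation separate its
elements. -/
theorem exists_weightSpace_ne_bot [Finite A] [IsMulCommutative A] [CharZero C]
    [HasEnoughRootsOfUnity C (Monoid.exponent A)] [Module.Free R M] [FaithfulSMul R C]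
    {a : A} (ha : τ a ≠ 1) :
    ∃ χ : A →* Cˣ, weightSpace τ χ ≠ ⊥ ∧ χ a ≠ 1 := by
  classical
  let _ : CommGroup A := { (inferInstance : Group A) with mul_comm := mul_comm' }
  have := Fintype.ofFinite A
  have : Finite (A →* Cˣ) :=
    Finite.of_equiv A (CommGroup.monoidHom_mulEquiv_of_hasEnoughRootsOfUnity A C).some.symm.toEquiv
  have := Fintype.ofFinite (A →* Cˣ)
  by_contra! hcon
  -- up to a scalar, `E χ` is the projection to the weight space of `χ`
  let E : (A →* Cˣ) → (C ⊗[R] M) → C ⊗[R] M := fun χ v =>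
    ∑ b, ((χ b⁻¹ : Cˣ) : C) • (τ b).baseChange C v
  have hE : ∀ χ v, E χ v ∈ weightSpace τ χ := by
    intro χ v b
    simp only [E]
    rw [map_sum, Finset.smul_sum, ← Equiv.sum_comp (Equiv.mulLeft b)
      (fun c => (χ b : C) • ((χ c⁻¹ : Cˣ) : C) • (τ c).baseChange C v)]
    refine Finset.sum_congr rfl fun c _ => ?_
    rw [map_smul, Equiv.coe_mulLeft, baseChange_rep_mul, smul_smul, ← Units.val_mul, ← map_mul,
      mul_inv_rev, mul_comm c⁻¹, mul_inv_cancel_left]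
  have hcomm : ∀ χ v, E χ ((τ a).baseChange C v) = (τ a).baseChange C (E χ v) := by
    intro χ v
    simp only [E]
    rw [map_sum]
    refine Finset.sum_congr rfl fun c _ => ?_
    rw [map_smul, ← baseChange_rep_mul, ← baseChange_rep_mul, mul_comm]
  have hfix : ∀ χ v, E χ ((τ a).baseChange C v) = E χ v := by
    intro χ v
    rw [hcomm]
    by_cases hb : weightSpace τ χ = ⊥
    · have h1 := hE χ v
      rw [hb, Submodule.mem_bot] at h1
      rw [h1, map_zero]
    · rw [hE χ v a, hcon χ hb, Units.val_one, one_smul]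
  have hsum : ∀ v, ∑ χ, E χ v = (Fintype.card (A →* Cˣ) : C) • v := by
    intro v
    simp only [E]
    rw [Finset.sum_comm]
    simp_rw [← Finset.sum_smul]
    rw [Finset.sum_eq_single 1]
    · rw [map_one, LinearMap.baseChange_one]
      simp
    · intro b _ hb
      obtain ⟨ψ, hψ⟩ := CommGroup.exists_apply_ne_one_of_hasEnoughRootsOfUnity A C
        (inv_ne_one.2 hb)
      have h1 : (ψ b⁻¹ : C) * ∑ χ : A →* Cˣ, (χ b⁻¹ : C) = ∑ χ : A →* Cˣ, (χ b⁻¹ : C) := by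
        rw [Finset.mul_sum, ← Equiv.sum_comp (Equiv.mulLeft ψ) (fun χ => ((χ b⁻¹ : Cˣ) : C))]
        simp
      have h2 : ((ψ b⁻¹ : C) - 1) * ∑ χ : A →* Cˣ, (χ b⁻¹ : C) = 0 := by
        rw [sub_mul, one_mul, h1, sub_self]
      rw [(mul_eq_zero.1 h2).resolve_left, zero_smul]
      rw [sub_eq_zero]
      exact fun h => hψ (Units.ext h)
    · simp
  have hcard : (Fintype.card (A →* Cˣ) : C) ≠ 0 := Nat.cast_ne_zero.2 Fintype.card_ne_zero
  have hV : ∀ v : C ⊗[R] M, (τ a).baseChange C v = v := by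
    intro v
    have h1 := hsum ((τ a).baseChange C v)
    simp_rw [hfix] at h1
    rw [hsum] at h1
    exact (smul_right_injective _ hcard h1).symm
  apply ha
  apply LinearMap.ext
  intro x
  have h1 := hV (1 ⊗ₜ x)
  rw [LinearMap.baseChange_tmul] at h1
  exact Module.Flat.tensorProduct_mk_injective R M C h1

end WeightSpace

/-! ### Cyclotomic extensions of the `p`-adic numbers -/

open Polynomial in
/-- The cyclotomic polynomials of `p`-power order are Eisenstein, hence irreducible, over the
`p`-adic numbers. -/
theorem Padic.irreducible_cyclotomic_prime_pow (p : ℕ) [Fact p.Prime] (k : ℕ) :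
    Irreducible (cyclotomic (p ^ (k + 1)) ℚ_[p]) := by
  have hE := cyclotomic_prime_pow_comp_X_add_one_isEisensteinAt p k
  set F : ℤ[X] := (cyclotomic (p ^ (k + 1)) ℤ).comp (X + 1)
  have hF : F.Monic := by
    have := (cyclotomic.monic (p ^ (k + 1)) ℤ).comp_X_add_C 1
    simpa [F] using this
  let φ : ℤ →+* ℤ_[p] := Int.castRingHom ℤ_[p]
  have hdvd : ∀ z : ℤ, ∀ n : ℕ, (z : ℤ_[p]) ∈ (Ideal.span {(p : ℤ_[p])}) ^ n ↔
      z ∈ (Ideal.span {(p : ℤ)}) ^ n := by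
    intro z n
    rw [Ideal.span_singleton_pow, Ideal.span_singleton_pow, Ideal.mem_span_singleton,
      Ideal.mem_span_singleton, PadicInt.pow_p_dvd_int_iff]
  have hE' : (F.map φ).IsEisensteinAt (Ideal.span {(p : ℤ_[p])}) := by
    refine (hF.map φ).isEisensteinAt_of_mem_of_notMem ?_ ?_ ?_
    · rw [← PadicInt.maximalIdeal_eq_span_p]
      exact Ideal.IsPrime.ne_top inferInstance
    · intro n hn
      rw [hF.natDegree_map] at hn
      have h1 := (hdvd (F.coeff n) 1).2 (by simpa using hE.mem hn)
      rw [coeff_map]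
      simpa using h1
    · rw [coeff_map]
      intro h
      exact hE.notMem ((hdvd _ 2).1 h)
  have hdeg : 0 < (F.map φ).natDegree := by
    rw [hF.natDegree_map]
    have h1 : F.natDegree = (cyclotomic (p ^ (k + 1)) ℤ).natDegree := by
      rw [natDegree_comp, show (X + 1 : ℤ[X]) = X + C 1 by simp, natDegree_X_add_C, mul_one]
    rw [h1, natDegree_cyclotomic]
    exact Nat.totient_pos.2 (pow_pos (Fact.out : p.Prime).pos _)
  have hirr : Irreducible (F.map φ) := by
    refine hE'.irreducible ?_ (hF.map φ).isPrimitive hdeg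
    rw [← PadicInt.maximalIdeal_eq_span_p]
    infer_instance
  have h2 : F.map φ = algEquivAevalXAddC (1 : ℤ_[p]) (cyclotomic (p ^ (k + 1)) ℤ_[p]) := by
    rw [Polynomial.map_comp, map_cyclotomic]
    simp [comp_eq_aeval]
  rw [h2, MulEquiv.irreducible_iff] at hirr
  have h3 := ((cyclotomic.monic (p ^ (k + 1)) ℤ_[p]).irreducible_iff_irreducible_map_fraction_map
    (K := ℚ_[p])).1 hirr
  rwa [map_cyclotomic] at h3

/-! ### The family of characters occurring in a representation -/

/-- The exponential `y ↦ ζ ^ y` of `p`-adic integers, for `ζ` a root of unity of order `p ^ k`. -/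
noncomputable def padicZetaPow {p : ℕ} [Fact p.Prime] {T : Type*} [CommGroup T] {k : ℕ} (ζ : T)
    (hζ : ζ ^ p ^ k = 1) : Multiplicative ℤ_[p] →* T where
  toFun y := ζ ^ (PadicInt.toZModPow k y.toAdd).val
  map_one' := by
    rw [toAdd_one, map_zero, ZMod.val_zero, pow_zero]
  map_mul' x y := by
    have : NeZero (p ^ k) := ⟨pow_ne_zero _ (Fact.out : p.Prime).ne_zero⟩
    rw [toAdd_mul, map_add, ZMod.val_add, ← pow_add,
      pow_eq_pow_mod ((PadicInt.toZModPow k x.toAdd).val + _) hζ]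

section PadicZetaPow

variable {p : ℕ} [Fact p.Prime] {T : Type*} [CommGroup T] {k : ℕ} {ζ : T} (hζ : ζ ^ p ^ k = 1)

theorem padicZetaPow_mul (r : ℤ_[p]) :
    ∃ m : ℕ, ∀ y : ℤ_[p], padicZetaPow ζ hζ (.ofAdd (r * y)) = padicZetaPow ζ hζ (.ofAdd y) ^ m := by
  refine ⟨(PadicInt.toZModPow k r).val, fun y => ?_⟩
  change ζ ^ (PadicInt.toZModPow k (r * y)).val = (ζ ^ (PadicInt.toZModPow k y).val) ^ _
  rw [map_mul, ZMod.val_mul, ← pow_eq_pow_mod _ hζ, ← pow_mul, mul_comm]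

theorem padicZetaPow_natCast (m : ℕ) : padicZetaPow ζ hζ (.ofAdd (m : ℤ_[p])) = ζ ^ m := by
  change ζ ^ (PadicInt.toZModPow k (m : ℤ_[p])).val = ζ ^ m
  rw [map_natCast, ZMod.val_natCast, ← pow_eq_pow_mod _ hζ]

end PadicZetaPow

/-- The nontrivial characters of a normal subgroup `A` occurring in a representation of `G`. -/
def OccurringCharacter {R G M : Type*} (C : Type*) [CommRing R] [Field C] [Algebra R C] [Group G]
    [AddCommGroup M] [Module R M] (ρ : Representation R G M) (A : Subgroup G) : Type _ :=
  {χ : A →* Cˣ // χ ≠ 1 ∧ weightSpace (ρ.comp A.subtype) χ ≠ ⊥}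

namespace OccurringCharacter

variable {R G M C : Type*} [CommRing R] [Field C] [Algebra R C] [Group G]
  [AddCommGroup M] [Module R M] {ρ : Representation R G M} {A : Subgroup G} [A.Normal]

theorem weightSpace_conj_ne_bot {χ : A →* Cˣ} (h : weightSpace (ρ.comp A.subtype) χ ≠ ⊥) (g : G) :
    weightSpace (ρ.comp A.subtype) (χ.comp (MulAut.conjNormal (H := A) g⁻¹).toMonoidHom) ≠ ⊥ := by
  obtain ⟨v, hv, hv0⟩ := Submodule.exists_mem_ne_zero_of_ne_bot h
  have hmul : ∀ (g h : G) (v : C ⊗[R] M),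
      (ρ (g * h)).baseChange C v = (ρ g).baseChange C ((ρ h).baseChange C v) := by
    intro g h v
    rw [map_mul, Module.End.mul_eq_comp, LinearMap.baseChange_comp]
    rfl
  refine (Submodule.ne_bot_iff _).2 ⟨(ρ g).baseChange C v, fun a => ?_, fun h0 => hv0 ?_⟩
  · change (ρ a).baseChange C ((ρ g).baseChange C v) =
      ((χ (MulAut.conjNormal g⁻¹ a) : Cˣ) : C) • (ρ g).baseChange C v
    have h1 : (ρ (g⁻¹ * a * g)).baseChange C v =
        ((χ (MulAut.conjNormal g⁻¹ a) : Cˣ) : C) • v := by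
      rw [← hv]
      simp
    rw [← map_smul, ← h1, ← hmul, ← hmul]
    congr 3
    group
  · have h1 := hmul g⁻¹ g v
    rw [h0, map_zero, inv_mul_cancel, map_one, LinearMap.baseChange_one] at h1
    exact h1

noncomputable instance : MulAction G (OccurringCharacter C ρ A) where
  smul g χ := ⟨χ.1.comp (MulAut.conjNormal (H := A) g⁻¹).toMonoidHom, fun h => χ.2.1 (by
    ext a
    have h1 := DFunLike.congr_fun h (MulAut.conjNormal g a)
    simpa using congrArg Units.val h1), weightSpace_conj_ne_bot χ.2.2 g⟩
  one_smul χ := by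
    apply Subtype.ext
    ext a
    change ((χ.1 (MulAut.conjNormal (1 : G)⁻¹ a) : Cˣ) : C) = _
    simp
  mul_smul g h χ := by
    apply Subtype.ext
    ext a
    change ((χ.1 (MulAut.conjNormal (g * h)⁻¹ a) : Cˣ) : C) =
      ((χ.1 (MulAut.conjNormal h⁻¹ (MulAut.conjNormal g⁻¹ a)) : Cˣ) : C)
    rw [mul_inv_rev, map_mul]
    rfl

theorem smul_val (g : G) (χ : OccurringCharacter C ρ A) (a : A) :
    (g • χ).1 a = χ.1 (MulAut.conjNormal g⁻¹ a) := rfl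

/-- The occurring characters form an odd family when an automorphism of the coefficients inverts
the roots of unity. -/
noncomputable def family [IsMulCommutative A] {p : ℕ} [Fact p.Prime] [Algebra ℤ_[p] C] [Module ℤ_[p] M]
    {ρ : Representation ℤ_[p] G M}
    (hp : Odd p) {k : ℕ} (hexp : ∀ a : A, a ^ p ^ k = 1) {ζ : Cˣ}
    (hζ : IsPrimitiveRoot ζ (p ^ k)) (σ : C ≃ₐ[ℤ_[p]] C) (hσ : σ (ζ : C) = (ζ⁻¹ : Cˣ))
    (hsep : ∀ a : A, a ≠ 1 → ∃ χ : A →* Cˣ, weightSpace (ρ.comp A.subtype) χ ≠ ⊥ ∧ χ a ≠ 1) :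
    OddCharacterFamily p A Cˣ (OccurringCharacter C ρ A) :=
  have hlog : ∀ (χ : A →* Cˣ) a, ∃ m : ℕ, ζ ^ m = χ a := fun χ a => by
    have h1 : χ a ^ p ^ k = 1 := by rw [← map_pow, hexp, map_one]
    have : NeZero (p ^ k) := ⟨pow_ne_zero _ (Fact.out : p.Prime).ne_zero⟩
    obtain ⟨i, -, hi⟩ := (IsPrimitiveRoot.coe_units_iff.2 hζ).eq_pow_of_pow_eq_one
      (ξ := ((χ a : Cˣ) : C)) (by rw [← Units.val_pow_eq_pow_val, h1, Units.val_one])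
    exact ⟨i, Units.ext (by rw [Units.val_pow_eq_pow_val, hi])⟩
  { e := padicZetaPow ζ hζ.pow_eq_one
    e_mul := padicZetaPow_mul hζ.pow_eq_one
    ch := fun χ => χ.1
    inv := fun χ => ⟨χ.1⁻¹, fun h => χ.2.1 (by
      rw [← inv_inv χ.1, h]
      ext
      simp),
      weightSpace_inv_ne_bot _ σ (fun a => by
        obtain ⟨m, hm⟩ := hlog χ.1 a
        rw [← hm, Units.val_pow_eq_pow_val, map_pow, hσ, ← Units.val_pow_eq_pow_val, inv_pow])
        χ.2.2⟩
    inv_inv := fun χ => Subtype.ext (inv_inv χ.1)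
    inv_ne := fun χ h => χ.2.1 (by
      have h1 : χ.1⁻¹ = χ.1 := congrArg Subtype.val h
      ext a
      have h2 : χ.1 a ^ 2 = 1 := by
        have h3 := DFunLike.congr_fun h1 a
        rw [MonoidHom.inv_apply] at h3
        rw [sq]
        nth_rewrite 1 [← h3]
        exact inv_mul_cancel _
      have h3 : χ.1 a ^ p ^ k = 1 := by rw [← map_pow, hexp, map_one]
      -- the order of the value divides both `2` and an odd number
      have h4 : orderOf (χ.1 a) ∣ 1 := by
        rw [← Nat.Coprime.gcd_eq_one (Nat.coprime_two_left.2 (hp.pow (n := k)))]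
        exact Nat.dvd_gcd (orderOf_dvd_of_pow_eq_one h2) (orderOf_dvd_of_pow_eq_one h3)
      rw [orderOf_eq_one_iff.1 (Nat.dvd_one.1 h4)]
      rfl)
    inv_smul := fun g χ => Subtype.ext (by ext a; rfl)
    ch_inv := fun χ a => rfl
    ch_smul := fun g χ a => rfl
    smul_eq := fun a ha χ => by
      apply Subtype.ext
      ext b
      rw [smul_val]
      congr 2
      apply Subtype.ext
      rw [MulAut.conjNormal_apply, inv_inv]
      have h1 : b * (⟨a, ha⟩ : A) = ⟨a, ha⟩ * b := mul_comm' _ _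
      have h2 : (b : G) * a = a * b := congrArg Subtype.val h1
      rw [mul_assoc, h2, inv_mul_cancel_left]
    separates := fun a h => by
      by_contra ha
      obtain ⟨χ, hχ, hχa⟩ := hsep a ha
      exact hχa (h ⟨χ, fun h1 => hχa (by rw [h1]; rfl), hχ⟩)
    exists_log := fun χ a => by
      obtain ⟨m, hm⟩ := hlog χ.1 a
      exact ⟨m, by rw [padicZetaPow_natCast, hm]⟩ }

omit [A.Normal] in
/-- The number of nontrivial occurring characters is at most the corank of the invariants. -/
theorem card_add_finrank_invariants_le [Finite A] [IsMulCommutative A] [CharZero C]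
    [HasEnoughRootsOfUnity C (Monoid.exponent A)]
    [IsDomain R] [IsPrincipalIdealRing R] [Module.Free R M]
    [Module.Finite R M] [Module.IsTorsionFree R C] :
    Nat.card (OccurringCharacter C ρ A) + Module.finrank R ρ.invariants ≤ Module.finrank R M := by
  classical
  let _ : CommGroup A := { (inferInstance : Group A) with mul_comm := mul_comm' }
  have : Finite (A →* Cˣ) :=
    Finite.of_equiv A (CommGroup.monoidHom_mulEquiv_of_hasEnoughRootsOfUnity A C).some.symm.toEquiv
  have := Fintype.ofFinite (A →* Cˣ)
  let W : (A →* Cˣ) → Submodule C (C ⊗[R] M) := weightSpace (ρ.comp A.subtype)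
  have h1 := (iSupIndep_weightSpace (C := C) (ρ.comp A.subtype)).sum_finrank_le
  rw [Module.finrank_baseChange, ← Finset.add_sum_erase _ _ (Finset.mem_univ 1)] at h1
  have h2 : Module.finrank R ρ.invariants ≤ Module.finrank C (W 1) := by
    refine le_trans ?_ (finrank_invariants_le (C := C) (ρ.comp A.subtype))
    exact Submodule.finrank_mono fun x hx a => hx a
  have h3 : Nat.card (OccurringCharacter C ρ A) ≤
      ∑ χ ∈ Finset.univ.erase 1, Module.finrank C (W χ) := by
    let S : Finset (A →* Cˣ) := (Finset.univ.erase 1).filter fun χ => W χ ≠ ⊥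
    have h4 : Nat.card (OccurringCharacter C ρ A) = S.card := by
      rw [OccurringCharacter, Nat.card_eq_fintype_card, Fintype.card_subtype]
      congr 1
      ext χ
      simp [S, W]
    rw [h4, Finset.card_eq_sum_ones]
    refine (Finset.sum_le_sum fun χ hχ => ?_).trans
      (Finset.sum_le_sum_of_subset (Finset.filter_subset _ _))
    exact Nat.one_le_iff_ne_zero.2 fun h =>
      (Finset.mem_filter.1 hχ).2 (Submodule.finrank_eq_zero.1 h)
  change Module.finrank C (W 1) + _ ≤ _ at h1
  change _ ≤ ∑ χ ∈ _, Module.finrank C (weightSpace (ρ.comp A.subtype) χ) at h3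
  omega

end OccurringCharacter


/-! ### The inequality for groups and lattices -/

/-- The bound `2 d(G) ≤ n - a` for a faithful lattice of rank `n` with invariants of rank `a`,
assuming `d(G ⧸ A) + d(Y) ≤ rank Y` for all faithful lattices `Y` of proper quotients of `G`. -/
theorem index_pFrattini_sq_mul_le.{u, v} {p : ℕ} [Fact p.Prime] (hp : Odd p) {G : Type u}
    [Group G] [Finite G] (hG : IsPGroup p G) {M : Type v} [AddCommGroup M] [Module ℤ_[p] M]
    [Module.Free ℤ_[p] M] [Module.Finite ℤ_[p] M] (ρ : Representation ℤ_[p] G M)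
    (hρ : ∀ g, ρ g = 1 → g = 1)
    (ih : ∀ (A : Subgroup G) [A.Normal], A ≠ ⊥ → ∀ (Y : Type u) [AddCommGroup Y]
      [Module ℤ_[p] Y] [Module.Free ℤ_[p] Y] [Module.Finite ℤ_[p] Y]
      (σ : Representation ℤ_[p] (G ⧸ A) Y), (∀ g, σ g = 1 → g = 1) →
      (pFrattini p (G ⧸ A)).index * σ.modAug.index ≤ p ^ Module.finrank ℤ_[p] Y) :
    (pFrattini p G).index ^ 2 * p ^ Module.finrank ℤ_[p] ρ.invariants ≤
      p ^ Module.finrank ℤ_[p] M := by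
  have hp1 : 1 ≤ p := (Fact.out : p.Prime).one_le
  obtain ⟨A, hAn, hAc, hAcent⟩ := hG.exists_normal_abelian_centralizer_le
  have hcomm : IsMulCommutative A := ⟨⟨fun a b => Subtype.ext (hAc a a.2 b b.2)⟩⟩
  by_cases hA : A = ⊥
  -- a trivial self-centralizing subgroup forces `G` to be trivial
  · have h1 : pFrattini p G = ⊤ := by
      rw [eq_top_iff]
      intro g _
      have h2 : g ∈ A := hAcent g fun a ha => by
        rw [hA, Subgroup.mem_bot] at ha
        rw [ha, mul_one, one_mul]
      rw [hA, Subgroup.mem_bot] at h2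
      rw [h2]
      exact one_mem _
    rw [h1, Subgroup.index_top, one_pow, one_mul]
    exact Nat.pow_le_pow_right hp1 (Submodule.finrank_le _)
  obtain ⟨k, hk⟩ := IsPGroup.iff_card.1 (hG.to_subgroup A)
  -- `k + 1` in place of `k` has the positive form that the irreducibility lemma asks for
  have : NeZero (p ^ (k + 1)) := ⟨pow_ne_zero _ (Fact.out : p.Prime).ne_zero⟩
  let C := CyclotomicField (p ^ (k + 1)) ℚ_[p]
  have hexp : ∀ a : A, a ^ p ^ (k + 1) = 1 := fun a => by
    rw [pow_succ, pow_mul, ← hk, pow_card_eq_one', one_pow]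
  have hζ₀ := IsCyclotomicExtension.zeta_spec (p ^ (k + 1)) ℚ_[p] C
  have hirr := Padic.irreducible_cyclotomic_prime_pow p k
  let ζ : Cˣ := hζ₀.isUnit (NeZero.ne _) |>.unit
  have hζ : IsPrimitiveRoot ζ (p ^ (k + 1)) := IsPrimitiveRoot.coe_units_iff.1 hζ₀
  let σ : C ≃ₐ[ℤ_[p]] C := (IsCyclotomicExtension.fromZetaAut hζ₀.inv hirr).restrictScalars ℤ_[p]
  have hσ : σ (ζ : C) = (ζ⁻¹ : Cˣ) := by
    rw [Units.val_inv_eq_inv_val]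
    exact IsCyclotomicExtension.fromZetaAut_spec hζ₀.inv hirr
  have hroots : HasEnoughRootsOfUnity C (Monoid.exponent A) := by
    have h1 : HasEnoughRootsOfUnity C (p ^ (k + 1)) := ⟨⟨_, hζ₀⟩, inferInstance⟩
    exact h1.of_dvd C (Monoid.exponent_dvd_of_forall_pow_eq_one hexp)
  have hsep : ∀ a : A, a ≠ 1 →
      ∃ χ : A →* Cˣ, weightSpace (ρ.comp A.subtype) χ ≠ ⊥ ∧ χ a ≠ 1 := fun a ha =>
    exists_weightSpace_ne_bot (C := C) (ρ.comp A.subtype)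
      fun h => ha (Subtype.ext (hρ (a : G) h))
  let D := OccurringCharacter.family (ρ := ρ) hp hexp hζ σ hσ hsep
  have hfin : Finite (OccurringCharacter C ρ A) := by
    let _ : CommGroup A := { (inferInstance : Group A) with mul_comm := mul_comm' }
    have : Finite (A →* Cˣ) := Finite.of_equiv A
      (CommGroup.monoidHom_mulEquiv_of_hasEnoughRootsOfUnity A C).some.symm.toEquiv
    exact Subtype.finite
  have hcount := OccurringCharacter.card_add_finrank_invariants_le (C := C) (ρ := ρ) (A := A)
  have hhalf := D.two_mul_finrank_lattice_le
  have h1 := ih A hA D.lattice D.quotientRep fun g hg =>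
    D.quotientRep_faithful hp hAcent g fun y => by rw [hg]; rfl
  have h2 := D.relIndex_pFrattini_le hp
  have h3 : (pFrattini p G).index ≤ p ^ Module.finrank ℤ_[p] D.lattice := by
    rw [index_pFrattini_eq A, mul_comm]
    exact (Nat.mul_le_mul_left _ h2).trans h1
  calc _ ≤ (p ^ Module.finrank ℤ_[p] D.lattice) ^ 2 * p ^ Module.finrank ℤ_[p] ρ.invariants := by
        gcongr
    _ ≤ _ := by
        rw [← pow_mul, ← pow_add]
        exact Nat.pow_le_pow_right hp1 (by omega)

/-- The two bounds `2 d(G) ≤ n - a` and `2 d(M) ≤ n + a` add up. -/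
theorem index_mul_index_le_of_sq_le {p : ℕ} [Fact p.Prime] (hp : Odd p) {G M : Type*} [Group G]
    [Finite G] (hG : IsPGroup p G) [AddCommGroup M] [Module ℤ_[p] M] [Module.Free ℤ_[p] M]
    [Module.Finite ℤ_[p] M] (ρ : Representation ℤ_[p] G M)
    (h : (pFrattini p G).index ^ 2 * p ^ Module.finrank ℤ_[p] ρ.invariants ≤
      p ^ Module.finrank ℤ_[p] M) :
    (pFrattini p G).index * ρ.modAug.index ≤ p ^ Module.finrank ℤ_[p] M := by
  have h1 := ρ.modAug_index_sq_le hp hG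
  have h2 := Nat.mul_le_mul h h1
  have hpos : 0 < p ^ Module.finrank ℤ_[p] ρ.invariants := pow_pos (Fact.out : p.Prime).pos _
  rw [pow_add] at h2
  have h3 : ((pFrattini p G).index * ρ.modAug.index) ^ 2 * p ^ Module.finrank ℤ_[p] ρ.invariants ≤
      (p ^ Module.finrank ℤ_[p] M) ^ 2 * p ^ Module.finrank ℤ_[p] ρ.invariants := by
    calc _ = _ := by ring
      _ ≤ _ := h2
      _ = _ := by ring
  exact (Nat.pow_le_pow_iff_left two_ne_zero).1 (Nat.le_of_mul_le_mul_right h3 hpos)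

/-- The inequality in terms of indices, for lattices in the universe of the group; this is the form
which reproduces itself in the induction on the order of the group. -/
theorem index_mul_index_le_of_same_universe.{u} {p : ℕ} [Fact p.Prime] (hp : Odd p) (n : ℕ) :
    ∀ (G : Type u) [Group G] [Finite G], IsPGroup p G → Nat.card G = n →
      ∀ (M : Type u) [AddCommGroup M] [Module ℤ_[p] M] [Module.Free ℤ_[p] M]
        [Module.Finite ℤ_[p] M] (ρ : Representation ℤ_[p] G M), (∀ g, ρ g = 1 → g = 1) →
        (pFrattini p G).index * ρ.modAug.index ≤ p ^ Module.finrank ℤ_[p] M := by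
  induction n using Nat.strong_induction_on with
  | _ n ih =>
  intro G _ _ hG hn M _ _ _ _ ρ hρ
  refine index_mul_index_le_of_sq_le hp hG ρ
    (index_pFrattini_sq_mul_le hp hG ρ hρ fun A _ hA Y _ _ _ _ σ hσ => ?_)
  refine ih _ ?_ (G ⧸ A) (hG.to_quotient A) rfl Y σ hσ
  rw [← hn, A.card_eq_card_quotient_mul_card_subgroup]
  exact lt_mul_of_one_lt_right Nat.card_pos ((Subgroup.one_lt_card_iff_ne_bot A).2 hA)

theorem index_mul_index_le {p : ℕ} [Fact p.Prime] (hp : Odd p) {G M : Type*} [Group G]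
    [Finite G] (hG : IsPGroup p G) [AddCommGroup M] [Module ℤ_[p] M] [Module.Free ℤ_[p] M]
    [Module.Finite ℤ_[p] M] (ρ : Representation ℤ_[p] G M) (hρ : ∀ g, ρ g = 1 → g = 1) :
    (pFrattini p G).index * ρ.modAug.index ≤ p ^ Module.finrank ℤ_[p] M :=
  index_mul_index_le_of_sq_le hp hG ρ
    (index_pFrattini_sq_mul_le hp hG ρ hρ fun A _ _ Y _ _ _ _ σ hσ =>
      index_mul_index_le_of_same_universe hp _ (G ⧸ A) (hG.to_quotient A) rfl Y σ hσ)

theorem mainTheorem5 (p : ℕ) [Fact p.Prime] (hp : Odd p)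
    {G : Type*} [Group G] [Finite G] (hG : IsPGroup p G)
    {M : Type*} [AddCommGroup M] [Module ℤ_[p] M] [Module (MonoidAlgebra ℤ_[p] G) M]
    [IsScalarTower ℤ_[p] (MonoidAlgebra ℤ_[p] G) M]
    [Module.Free ℤ_[p] M] [Module.Finite ℤ_[p] M]
    (hfaithful : ∀ g : G, (∀ m : M, MonoidAlgebra.of ℤ_[p] G g • m = m) → g = 1) :
    (Group.rank G : Cardinal) + (⊤ : Submodule (MonoidAlgebra ℤ_[p] G) M).spanRank
      ≤ Module.rank ℤ_[p] M := by
  obtain ⟨d, hd, hdp⟩ := exists_spanRank_le_and_pow_eq_index_modAug hG (M := M)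
  have h1 := index_mul_index_le hp hG (Representation.ofModule' (k := ℤ_[p]) (G := G) M)
    fun g hg => hfaithful g fun m => by
      have h := LinearMap.congr_fun hg m
      simpa [Representation.ofModule', MonoidAlgebra.lift_symm_apply] using h
  have h2 := (Nat.mul_le_mul_right _ (pow_rank_le_index_pFrattini hG)).trans h1
  rw [← hdp, ← pow_add] at h2
  have h3 := (Nat.pow_le_pow_iff_right (Fact.out : p.Prime).one_lt).1 h2
  rw [← Module.finrank_eq_rank]
  refine (add_le_add_right hd _).trans ?_
  exact_mod_cast h3
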